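/- For $a,q\in\mathbb{C}$ and $n\ge 0$ let $(a;q)_n=\prod_{j=0}^{n-1}(1-aq^j)$. For $s\in\mathbb{C}$, $|z|<1$, $|q|<1$ put $$\sigma_s(n)=\sum_{d\mid n}d^s,\qquad \sigma_{s,z}(n)=\sum_{d\mid n}d^s z^d,\qquad \mathrm{Li}_s(z)=\sum_{n\ge1}\frac{z^n}{n^s},$$ $$\mathfrak{S}_{s,z}(q)=\sum_{n\ge1}\sigma_s(n)q^n-\mathrm{Li}_{-s}(z)-\sum_{n\ge1}\sigma_{s,z}(n)q^n .$$ Then there are polynomials $M_k(x_1,\dots,x_k)\in\mathbb{Q}[x_1,\dots,x_k]$, $k=1,2,3,\dots$, each depending on $k$ only, such that for every integer $k\ge1$ and all complex $q,z$ with $|q|<1$, $|z|<1$, $$\sum_{n=1}^{\infty}\frac{(q/z;q)_n\,z^n}{(1-q^n)^k\,(q;q)_n}=-M_k\bigl(\mathfrak{S}_{0,z}(q),\mathfrak{S}_{1,z}(q),\dots,\mathfrak{S}_{k-1,z}(q)\bigr),$$ where the series converges absolutely, and where for $z=0$ the expression $(q/z;q)_n z^n$ is understood as its limit $(-1)^n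 q^{n(n+1)/2}$ as $z\to0$. Moreover these polynomials can be chosen with $M_1(x_1)=x_1$ and $M_2(x_1,x_2)=\tfrac12\,(x_1^2+x_1+x_2)$. -/

import Mathlib

/-- The finite `q`-Pochhammer symbol `(a; q)_n = ∏_{j=0}^{n-1} (1 - a q^j)`. -/
def qPoch (a q : ℂ) (n : ℕ) : ℂ :=
  ∏ j ∈ Finset.range n, (1 - a * q ^ j)

/-- The divisor function `σ_s(n) = ∑_{d ∣ n} d^s` with complex exponent `s`. -/
noncomputable def divisorSigma (s : ℂ) (n : ℕ) : ℂ :=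
  ∑ d ∈ n.divisors, (d : ℂ) ^ s

/-- The generalized divisor function `σ_{s,z}(n) = ∑_{d ∣ n} d^s z^d`. -/
noncomputable def genDivisorSigma (s z : ℂ) (n : ℕ) : ℂ :=
  ∑ d ∈ n.divisors, (d : ℂ) ^ s * z ^ d

/-- The polylogarithm `Li_s(z) = ∑_{n ≥ 1} z^n / n^s`
(absolutely convergent for `|z| < 1`). -/
noncomputable def polylog (s z : ℂ) : ℂ :=
  ∑' n : ℕ, z ^ (n + 1) / ((n + 1 : ℕ) : ℂ) ^ s

/-- `S_s(q) = ∑_{n ≥ 1} σ_s(n) q^n` (absolutely convergent for `|q| < 1`). -/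
noncomputable def sigmaSeries (s q : ℂ) : ℂ :=
  ∑' n : ℕ, divisorSigma s (n + 1) * q ^ (n + 1)

/-- `S_{s,z}(q) = Li_{-s}(z) + ∑_{n ≥ 1} σ_{s,z}(n) q^n`
(absolutely convergent for `|q| < 1`, `|z| < 1`). -/
noncomputable def genSigmaSeries (s z q : ℂ) : ℂ :=
  polylog (-s) z + ∑' n : ℕ, genDivisorSigma s z (n + 1) * q ^ (n + 1)

/-- `𝔖_{s,z}(q) = S_s(q) - S_{s,z}(q)`. -/
noncomputable def frakS (s z q : ℂ) : ℂ :=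
  sigmaSeries s q - genSigmaSeries s z q

open Filter Topology

/-! ### A telescoping family of power series -/

section Telescoping

open PowerSeries

/-! Let a_n be the summand without the powers of 1 - q^n, and put F_N(X) = ∑ a_n (1 - zq^N - X)/(1 -
q^(n+N+1) - X), expanded at X = 0. The first-order recurrence of a_n gives (1 - q^(N+1) - X) F_N =
(1 - zq^N - X) F_(N+1), and F_N tends to the constant A = ∑ a_n. Hence F_0 = A ∏ (1 - zq^m - X)/(1 -
q^(m+1) - X), a form of the q-binomial theorem.

The coefficients of F_0 are 1 and then minus the sums of the theorem (`coeff_qSeries`). The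
logarithmic derivative of the product yields a Newton recurrence (`newton_of_telescoping`) whose
power sums are ∑ (1 - q^(m+1))^(-k-1) - (1 - zq^m)^(-k-1). The negative binomial series turns these
into rational combinations of 𝔖_0, ..., 𝔖_k (`hasSum_inv_pow_sub_inv_pow`), so solving the
recurrence gives universal polynomials. -/

/-- The expansion of `1 / (u - X)` for `u ≠ 0`. -/
noncomputable def geomSeries (u : ℂ) : PowerSeries ℂ :=
  PowerSeries.mk fun k => u⁻¹ ^ (k + 1)

lemma geomSeries_mul {u : ℂ} (hu : u ≠ 0) : geomSeries u * (C u - X) = 1 := by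
  ext k
  rw [mul_sub, map_sub, coeff_mul_C]
  cases k with
  | zero => simp [geomSeries, hu]
  | succ k =>
    rw [coeff_succ_mul_X]
    simp only [geomSeries, coeff_mk, coeff_one]
    rw [pow_succ u⁻¹ (k + 1)]
    simp [hu]

lemma derivative_geomSeries {u : ℂ} (hu : u ≠ 0) :
    d⁄dX ℂ (geomSeries u) = geomSeries u ^ 2 := by
  have h := congrArg (d⁄dX ℂ) (geomSeries_mul hu)
  rw [Derivation.leibniz] at h
  simp only [map_sub, derivative_C, derivative_X, derivative_one, smul_eq_mul] at h
  linear_combination geomSeries u * h - d⁄dX ℂ (geomSeries u) * geomSeries_mul hu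

/-- If `(α_N - X) G_N = (β_N - X) G_{N+1}`, then the logarithmic derivatives of `G_0` and `G_N`
differ by the sum of the `1 / (α_m - X) - 1 / (β_m - X)`. -/
lemma wronskian_eq_of_telescoping {G : ℕ → PowerSeries ℂ} {α β : ℕ → ℂ}
    (hα : ∀ N, α N ≠ 0) (hβ : ∀ N, β N ≠ 0)
    (hG : ∀ N, (C (α N) - X) * G N = (C (β N) - X) * G (N + 1)) (N : ℕ) :
    d⁄dX ℂ (G 0) * G N - G 0 * d⁄dX ℂ (G N) =
      G 0 * G N * ∑ m ∈ Finset.range N, (geomSeries (α m) - geomSeries (β m)) := by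
  induction N with
  | zero => simp; ring
  | succ N ih =>
    have h1 := geomSeries_mul (hα N)
    have h2 := geomSeries_mul (hβ N)
    have hs : G (N + 1) = geomSeries (β N) * (C (α N) - X) * G N := by
      linear_combination geomSeries (β N) * (-hG N) - G (N + 1) * h2
    have hd : d⁄dX ℂ (G (N + 1)) = geomSeries (β N) * (C (α N) - X) * d⁄dX ℂ (G N) +
        (geomSeries (β N) ^ 2 * (C (α N) - X) - geomSeries (β N)) * G N := by
      rw [hs, Derivation.leibniz, Derivation.leibniz, derivative_geomSeries (hβ N)]
      simp only [map_sub, derivative_C, derivative_X, smul_eq_mul]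
      ring
    rw [Finset.sum_range_succ, hd, hs]
    linear_combination geomSeries (β N) * (C (α N) - X) * ih -
      G 0 * G N * geomSeries (β N) * h1

/-- Newton-type recurrence for the coefficients of `G_0`, when the series `G_N` tend to a nonzero
constant. -/
lemma newton_of_telescoping {G : ℕ → PowerSeries ℂ} {α β : ℕ → ℂ} {A : ℂ} {p : ℕ → ℂ}
    (hα : ∀ N, α N ≠ 0) (hβ : ∀ N, β N ≠ 0)
    (hG : ∀ N, (C (α N) - X) * G N = (C (β N) - X) * G (N + 1))
    (hA : A ≠ 0)
    (hlim : ∀ k, Tendsto (fun N => coeff k (G N)) atTop (𝓝 (if k = 0 then A else 0)))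
    (hp : ∀ k, HasSum (fun m => (α m)⁻¹ ^ (k + 1) - (β m)⁻¹ ^ (k + 1)) (p k)) (k : ℕ) :
    (k + 1) * coeff (k + 1) (G 0) =
      ∑ ij ∈ Finset.HasAntidiagonal.antidiagonal k, coeff ij.1 (G 0) * p ij.2 := by
  -- Coefficientwise limits respect products, each coefficient being a finite sum.
  have hmul : ∀ {F : ℕ → PowerSeries ℂ} {H : ℕ → PowerSeries ℂ} {f h : PowerSeries ℂ},
      (∀ k, Tendsto (fun N => coeff k (F N)) atTop (𝓝 (coeff k f))) →
      (∀ k, Tendsto (fun N => coeff k (H N)) atTop (𝓝 (coeff k h))) →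
      ∀ k, Tendsto (fun N => coeff k (F N * H N)) atTop (𝓝 (coeff k (f * h))) := by
    intro F H f h hF hH k
    simp only [coeff_mul]
    exact tendsto_finsetSum _ fun i _ => (hF i.1).mul (hH i.2)
  have hG1 : ∀ k, Tendsto (fun N => coeff k (G N)) atTop (𝓝 (coeff k (C A))) := by
    intro k
    rw [coeff_C]
    exact hlim k
  have hG2 : ∀ k, Tendsto (fun N => coeff k (d⁄dX ℂ (G N))) atTop
      (𝓝 (coeff k (0 : PowerSeries ℂ))) := by
    intro k
    simp only [coeff_derivative]
    simpa using (hlim (k + 1)).mul_const ((k : ℂ) + 1)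
  have hT : ∀ k, Tendsto (fun N => coeff k
      (∑ m ∈ Finset.range N, (geomSeries (α m) - geomSeries (β m)))) atTop
      (𝓝 (coeff k (PowerSeries.mk p))) := by
    intro k
    simp only [map_sum, map_sub, geomSeries, coeff_mk]
    exact (hp k).tendsto_sum_nat
  have hc : ∀ (f : PowerSeries ℂ) k, Tendsto (fun _ : ℕ => coeff k f) atTop (𝓝 (coeff k f)) :=
    fun f k => tendsto_const_nhds
  have hL : Tendsto (fun N => coeff k (d⁄dX ℂ (G 0) * G N - G 0 * d⁄dX ℂ (G N))) atTop
      (𝓝 (coeff k (d⁄dX ℂ (G 0) * C A) - coeff k (G 0 * 0))) := by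
    simp only [map_sub]
    exact (hmul (hc _) hG1 k).sub (hmul (hc _) hG2 k)
  have hR := hmul (hmul (hc (G 0)) hG1) hT k
  simp only [wronskian_eq_of_telescoping hα hβ hG] at hL
  have h := tendsto_nhds_unique hL hR
  rw [mul_zero, map_zero, sub_zero, coeff_mul_C, mul_right_comm, coeff_mul_C] at h
  have h' := mul_right_cancel₀ hA h
  rw [coeff_derivative, coeff_mul] at h'
  simp only [coeff_mk] at h'
  rw [mul_comm, h']

end Telescoping

/-! ### Lambert series -/

/-- The polylogarithm of order `-s`, as a power series in `w`. -/
noncomputable def powerSum (s : ℕ) (w : ℂ) : ℂ :=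
  ∑' d : ℕ, ((d : ℂ) + 1) ^ s * w ^ (d + 1)

lemma summable_powerSum (s : ℕ) {w : ℂ} (hw : ‖w‖ < 1) :
    Summable fun d : ℕ => ((d : ℂ) + 1) ^ s * w ^ (d + 1) := by
  simpa using (summable_nat_add_iff (f := fun d : ℕ => (d : ℂ) ^ s * w ^ d) 1).2
    (summable_pow_mul_geometric_of_norm_lt_one s hw)

/-- The absolutely convergent double sum of d^s (y q^m)^d is regrouped by n = md. Allowing ‖y‖ = 1
covers the ordinary divisor sums, y = 1. -/
lemma hasSum_powerSum_lambert (s : ℕ) {q y : ℂ} (hq : ‖q‖ < 1) (hy : ‖y‖ ≤ 1) :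
    HasSum (fun m : ℕ => powerSum s (y * q ^ (m + 1)))
      (∑' n : ℕ, genDivisorSigma s y (n + 1) * q ^ (n + 1)) := by
  have hsum : Summable fun c : ℕ+ × ℕ+ =>
      ((c.2 : ℕ) : ℂ) ^ s * (y * q ^ (c.1 : ℕ)) ^ (c.2 : ℕ) := by
    refine Summable.of_norm_bounded (summable_prod_mul_pow s hq).norm fun c => ?_
    rw [norm_mul, norm_mul, mul_pow, norm_mul, pow_mul, norm_pow y]
    gcongr
    exact mul_le_of_le_one_left (norm_nonneg _) (pow_le_one₀ (norm_nonneg _) hy)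
  have hpnat : ∀ w : ℂ, ∑' d : ℕ+, ((d : ℕ) : ℂ) ^ s * w ^ (d : ℕ) = powerSum s w := by
    intro w
    rw [tsum_pnat_eq_tsum_succ (f := fun d : ℕ => (d : ℂ) ^ s * w ^ d)]
    simp [powerSum]
  have hm : Summable fun m : ℕ+ => powerSum s (y * q ^ (m : ℕ)) := by
    simpa only [hpnat] using hsum.prod
  have hm' : Summable fun m : ℕ => powerSum s (y * q ^ (m + 1)) :=
    summable_pnat_iff_summable_succ (f := fun m : ℕ => powerSum s (y * q ^ m)) |>.1 hm
  convert hm'.hasSum using 1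
  rw [← tsum_pnat_eq_tsum_succ (f := fun m : ℕ => powerSum s (y * q ^ m)),
    ← tsum_pnat_eq_tsum_succ (f := fun n : ℕ => genDivisorSigma s y n * q ^ n)]
  simp only [← hpnat]
  have hsigma := sigmaAntidiagonalEquivProd.summable_iff.2 hsum
  simp only [Function.comp_def] at hsigma
  rw [← hsum.tsum_prod, ← sigmaAntidiagonalEquivProd.tsum_eq, hsigma.tsum_sigma]
  refine tsum_congr fun n => ?_
  rw [tsum_fintype]
  simp only [sigmaAntidiagonalEquivProd, divisorsAntidiagonalFactors, Equiv.coe_fn_mk,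
    PNat.mk_coe, Finset.univ_eq_attach]
  rw [(n : ℕ).divisorsAntidiagonal.sum_attach
      fun x : ℕ × ℕ => (x.2 : ℂ) ^ s * (y * q ^ x.1) ^ x.2,
    Nat.sum_divisorsAntidiagonal' fun a b => (b : ℂ) ^ s * (y * q ^ a) ^ b,
    genDivisorSigma, Finset.sum_mul]
  refine Finset.sum_congr rfl fun d hd => ?_
  rw [mul_pow, ← pow_mul, Nat.div_mul_cancel (Nat.dvd_of_mem_divisors hd), Complex.cpow_natCast,
    mul_assoc]

lemma hasSum_powerSum_sigmaSeries (s : ℕ) {q : ℂ} (hq : ‖q‖ < 1) :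
    HasSum (fun m : ℕ => powerSum s (q ^ (m + 1))) (sigmaSeries s q) := by
  simpa [sigmaSeries, divisorSigma, genDivisorSigma] using
    hasSum_powerSum_lambert s hq (y := 1) (by simp)

lemma hasSum_powerSum_genSigmaSeries (s : ℕ) {q z : ℂ} (hq : ‖q‖ < 1) (hz : ‖z‖ < 1) :
    HasSum (fun m : ℕ => powerSum s (z * q ^ m)) (genSigmaSeries s z q) := by
  -- The extra term m = 0 is the polylogarithm.
  have h := (hasSum_powerSum_lambert s hq hz.le).zero_add (f := fun m => powerSum s (z * q ^ m))
  have h0 : polylog (-s) z = powerSum s (z * q ^ 0) := by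
    rw [polylog, powerSum]
    refine tsum_congr fun d => ?_
    rw [Complex.cpow_neg, Complex.cpow_natCast, div_inv_eq_mul, mul_comm]
    simp
  rw [genSigmaSeries, h0]
  exact h

open Polynomial in
/-- The polynomial `binom(X + k, k)`. -/
noncomputable def binomPoly : ℕ → ℚ[X]
  | 0 => 1
  | k + 1 => binomPoly k * (C ((1 : ℚ) / (k + 1)) * (X + C ((k : ℚ) + 1)))

lemma natDegree_binomPoly_le (k : ℕ) : (binomPoly k).natDegree ≤ k := by
  induction k with
  | zero => simp [binomPoly]
  | succ k ih =>
    rw [binomPoly]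
    refine Polynomial.natDegree_mul_le_of_le ih ?_
    refine (Polynomial.natDegree_C_mul_le _ _).trans ?_
    exact (Polynomial.natDegree_X_add_C _).le

lemma aeval_binomPoly (k d : ℕ) :
    Polynomial.aeval (d : ℂ) (binomPoly k) = ((d + k).choose k : ℂ) := by
  induction k with
  | zero => simp [binomPoly]
  | succ k ih =>
    have h := Nat.add_one_mul_choose_eq (d + k) k
    have h' : ((d : ℂ) + k + 1) * ((d + k).choose k : ℂ) =
        ((d + (k + 1)).choose (k + 1) : ℂ) * (k + 1) := by
      exact_mod_cast h
    have hk : (k : ℂ) + 1 ≠ 0 := by exact_mod_cast k.succ_ne_zero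
    simp only [binomPoly, map_mul, ih, Polynomial.aeval_C, map_add, Polynomial.aeval_X]
    simp only [eq_ratCast]
    push_cast
    field_simp
    linear_combination h'

/-- Negative binomial series; the -1 removes the term d = 0 and cancels in differences. -/
lemma sum_coeff_binomPoly_mul_powerSum (k : ℕ) {w : ℂ} (hw : ‖w‖ < 1) :
    ∑ s ∈ Finset.range (k + 1), ((binomPoly k).coeff s : ℂ) * powerSum s w =
      (1 - w)⁻¹ ^ (k + 1) - 1 := by
  have h1 : HasSum (fun d : ℕ => ∑ s ∈ Finset.range (k + 1),
      ((binomPoly k).coeff s : ℂ) * (((d : ℂ) + 1) ^ s * w ^ (d + 1)))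
      (∑ s ∈ Finset.range (k + 1), ((binomPoly k).coeff s : ℂ) * powerSum s w) :=
    hasSum_sum fun s _ => (summable_powerSum s hw).hasSum.mul_left _
  have h2 := (hasSum_nat_add_iff' (f := fun d : ℕ => ((d + k).choose k : ℂ) * w ^ d) 1).2
    (hasSum_choose_mul_geometric_of_norm_lt_one k hw)
  have h3 : ∀ d : ℕ, ∑ s ∈ Finset.range (k + 1),
      ((binomPoly k).coeff s : ℂ) * (((d : ℂ) + 1) ^ s * w ^ (d + 1)) =
      ((d + 1 + k).choose k : ℂ) * w ^ (d + 1) := by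
    intro d
    rw [← aeval_binomPoly k (d + 1), Polynomial.aeval_eq_sum_range'
      (Nat.lt_succ_of_le (natDegree_binomPoly_le k)), Finset.sum_mul]
    refine Finset.sum_congr rfl fun s _ => ?_
    rw [Rat.smul_def]
    push_cast
    ring
  simp only [h3] at h1
  rw [h1.unique h2]
  simp

/-- The power sums occurring in the Newton recurrence, as linear forms in the `𝔖_{s,z}(q)`. -/
lemma hasSum_inv_pow_sub_inv_pow {q z : ℂ} (hq : ‖q‖ < 1) (hz : ‖z‖ < 1) (k : ℕ) :
    HasSum (fun m : ℕ => (1 - q ^ (m + 1))⁻¹ ^ (k + 1) - (1 - z * q ^ m)⁻¹ ^ (k + 1))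
      (∑ s ∈ Finset.range (k + 1), ((binomPoly k).coeff s : ℂ) * frakS s z q) := by
  have h : HasSum (fun m : ℕ => ∑ s ∈ Finset.range (k + 1), ((binomPoly k).coeff s : ℂ) *
      (powerSum s (q ^ (m + 1)) - powerSum s (z * q ^ m)))
      (∑ s ∈ Finset.range (k + 1), ((binomPoly k).coeff s : ℂ) * frakS s z q) :=
    hasSum_sum fun s _ => ((hasSum_powerSum_sigmaSeries s hq).sub
      (hasSum_powerSum_genSigmaSeries s hq hz)).mul_left _
  convert h using 2 with m
  have hw1 : ‖q ^ (m + 1)‖ < 1 := by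
    rw [norm_pow]
    exact pow_lt_one₀ (norm_nonneg _) hq m.succ_ne_zero
  have hw2 : ‖z * q ^ m‖ < 1 := by
    rw [norm_mul, norm_pow]
    exact mul_lt_one_of_nonneg_of_lt_one_left (norm_nonneg _) hz
      (pow_le_one₀ (norm_nonneg _) hq.le)
  simp only [mul_sub, Finset.sum_sub_distrib]
  rw [sum_coeff_binomPoly_mul_powerSum k hw1, sum_coeff_binomPoly_mul_powerSum k hw2]
  ring

/-! ### Sums over a `q`-hypergeometric sequence -/

section QHypergeometric

open PowerSeries

/-- Termwise, (u - X)/(v - X) = 1 + (u - v)/(v - X). -/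
lemma coeff_C_sub_X_mul_mk_tsum {a v : ℕ → ℂ} (hv : ∀ n, v n ≠ 0)
    (hs : ∀ k, Summable fun n => a n * (v n)⁻¹ ^ k) (u : ℂ) (k : ℕ) :
    coeff k ((C u - X) * PowerSeries.mk fun k => ∑' n, a n * (v n)⁻¹ ^ (k + 1)) =
      (if k = 0 then ∑' n, a n else 0) + ∑' n, a n * (u - v n) * (v n)⁻¹ ^ (k + 1) := by
  have h : ∑' n, a n * (u - v n) * (v n)⁻¹ ^ (k + 1) =
      u * ∑' n, a n * (v n)⁻¹ ^ (k + 1) - ∑' n, a n * (v n)⁻¹ ^ k := by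
    rw [← tsum_mul_left, ← ((hs (k + 1)).mul_left u).tsum_sub (hs k)]
    refine tsum_congr fun n => ?_
    have := hv n
    rw [pow_succ]
    field_simp
  rw [h, sub_mul, map_sub, coeff_C_mul, coeff_mk]
  cases k with
  | zero => simp
  | succ k => simp [coeff_succ_X_mul]

lemma one_sub_pow_ne_zero {q : ℂ} (hq : ‖q‖ < 1) (n : ℕ) : 1 - q ^ (n + 1) ≠ 0 := by
  intro h
  have h' : ‖q ^ (n + 1)‖ < 1 := by
    rw [norm_pow]
    exact pow_lt_one₀ (norm_nonneg _) hq n.succ_ne_zero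
  rw [← sub_eq_zero.1 h, norm_one] at h'
  exact lt_irrefl _ h'

lemma one_sub_mul_pow_ne_zero {q z : ℂ} (hq : ‖q‖ < 1) (hz : ‖z‖ < 1) (n : ℕ) :
    1 - z * q ^ n ≠ 0 := by
  intro h
  have h' : ‖z * q ^ n‖ < 1 := by
    rw [norm_mul, norm_pow]
    exact mul_lt_one_of_nonneg_of_lt_one_left (norm_nonneg _) hz
      (pow_le_one₀ (norm_nonneg _) hq.le)
  rw [← sub_eq_zero.1 h, norm_one] at h'
  exact lt_irrefl _ h'

lemma norm_inv_one_sub_pow_le {q : ℂ} (hq : ‖q‖ < 1) (n : ℕ) :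
    ‖(1 - q ^ (n + 1))⁻¹‖ ≤ (1 - ‖q‖)⁻¹ := by
  rw [norm_inv]
  refine inv_anti₀ (sub_pos.2 hq) ?_
  have h1 : ‖q ^ (n + 1)‖ ≤ ‖q‖ := by
    rw [norm_pow]
    exact pow_le_of_le_one (norm_nonneg _) hq.le n.succ_ne_zero
  have h2 := norm_sub_norm_le (1 : ℂ) (q ^ (n + 1))
  rw [norm_one] at h2
  linarith

lemma tendsto_pow_succ_zero {q : ℂ} (hq : ‖q‖ < 1) :
    Tendsto (fun n : ℕ => q ^ (n + 1)) atTop (𝓝 0) :=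
  (tendsto_pow_atTop_nhds_zero_of_norm_lt_one hq).comp (tendsto_add_atTop_nat 1)

variable {q z : ℂ} {a : ℕ → ℂ}

lemma summable_of_qRecurrence (hq : ‖q‖ < 1) (hz : ‖z‖ < 1)
    (ha : ∀ n, a (n + 1) * (1 - q ^ (n + 1)) = a n * (z - q ^ (n + 1))) : Summable a := by
  have hlim : Tendsto (fun n : ℕ => ‖(z - q ^ (n + 1)) / (1 - q ^ (n + 1))‖) atTop (𝓝 ‖z‖) := by
    have h := (((tendsto_pow_succ_zero hq).const_sub z).div
      ((tendsto_pow_succ_zero hq).const_sub 1) (by simp)).norm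
    simpa using h
  obtain ⟨ρ, hρ1, hρ2⟩ := exists_between hz
  refine summable_of_ratio_norm_eventually_le hρ2 ?_
  filter_upwards [hlim.eventually_le_const hρ1] with n hn
  have h : a (n + 1) = (z - q ^ (n + 1)) / (1 - q ^ (n + 1)) * a n := by
    have := one_sub_pow_ne_zero hq n
    field_simp
    linear_combination ha n
  rw [h, norm_mul]
  gcongr

lemma norm_mul_inv_one_sub_pow_le (hq : ‖q‖ < 1) (b : ℂ) (n k : ℕ) :
    ‖b * (1 - q ^ (n + 1))⁻¹ ^ k‖ ≤ ‖b‖ * (1 - ‖q‖)⁻¹ ^ k := by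
  rw [norm_mul, norm_pow]
  gcongr
  exact norm_inv_one_sub_pow_le hq n

lemma summable_mul_inv_one_sub_pow (hq : ‖q‖ < 1) {b : ℕ → ℂ} (hb : Summable b) (N k : ℕ) :
    Summable fun n => b n * (1 - q ^ (n + N + 1))⁻¹ ^ k :=
  Summable.of_norm_bounded (hb.norm.mul_right _) fun n =>
    norm_mul_inv_one_sub_pow_le hq (b n) (n + N) k

/-- The expansion in powers of `X` of `∑ a_n (1 - z q^N - X) / (1 - q^(n+N+1) - X)`. -/
noncomputable def qSeries (q z : ℂ) (a : ℕ → ℂ) (N : ℕ) : PowerSeries ℂ :=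
  (C (1 - z * q ^ N) - X) *
    PowerSeries.mk fun k => ∑' n, a n * (1 - q ^ (n + N + 1))⁻¹ ^ (k + 1)

/-- Here u - v_n = -q^N (z - q^(n+1)), and the recurrence replaces a_n (z - q^(n+1)) by a_(n+1) (1 -
q^(n+1)). -/
lemma coeff_qSeries (hq : ‖q‖ < 1) (hs : Summable a)
    (ha : ∀ n, a (n + 1) * (1 - q ^ (n + 1)) = a n * (z - q ^ (n + 1))) (N k : ℕ) :
    coeff k (qSeries q z a N) = (if k = 0 then ∑' n, a n else 0) -
      q ^ N * ∑' n, a (n + 1) * (1 - q ^ (n + 1)) * (1 - q ^ (n + N + 1))⁻¹ ^ (k + 1) := by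
  rw [qSeries, coeff_C_sub_X_mul_mk_tsum (fun n => one_sub_pow_ne_zero hq (n + N))
    (summable_mul_inv_one_sub_pow hq hs N), ← tsum_mul_left, sub_eq_add_neg (ite _ _ _), ← tsum_neg]
  congr 1
  refine tsum_congr fun n => ?_
  rw [ha]
  ring

lemma qSeries_telescoping (hq : ‖q‖ < 1) (hs : Summable a)
    (ha : ∀ n, a (n + 1) * (1 - q ^ (n + 1)) = a n * (z - q ^ (n + 1))) (N : ℕ) :
    (C (1 - q ^ (N + 1)) - X) * qSeries q z a N =
      (C (1 - z * q ^ N) - X) * qSeries q z a (N + 1) := by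
  rw [qSeries, mul_left_comm]
  congr 1
  ext k
  rw [coeff_qSeries hq hs ha, coeff_C_sub_X_mul_mk_tsum
    (fun n => one_sub_pow_ne_zero hq (n + N)) (summable_mul_inv_one_sub_pow hq hs N),
    ← tsum_mul_left, sub_eq_add_neg (ite _ _ _), ← tsum_neg]
  congr 1
  have hsum : Summable fun n => a n * (1 - q ^ (N + 1) - (1 - q ^ (n + N + 1))) *
      (1 - q ^ (n + N + 1))⁻¹ ^ (k + 1) := by
    refine Summable.congr
      (((summable_mul_inv_one_sub_pow hq hs N (k + 1)).mul_left (1 - q ^ (N + 1))).sub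
        (summable_mul_inv_one_sub_pow hq hs N k)) fun n => ?_
    have := one_sub_pow_ne_zero hq (n + N)
    rw [pow_succ _ k]
    linear_combination a n * (1 - q ^ (n + N + 1))⁻¹ ^ k * mul_inv_cancel₀ this
  -- The term n = 0 carries the factor q^(N+1) - q^(N+1) = 0; shifting the index matches the
  -- expansion of F_(N+1).
  rw [hsum.tsum_eq_zero_add]
  simp only [zero_add, sub_self, mul_zero, zero_mul]
  refine tsum_congr fun n => ?_
  rw [show n + 1 + N + 1 = n + (N + 1) + 1 by ring]
  ring

lemma summable_qRecurrence_mul (hq : ‖q‖ < 1) (hs : Summable a) :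
    Summable fun n => a (n + 1) * (1 - q ^ (n + 1)) := by
  refine Summable.of_norm_bounded (((summable_nat_add_iff 1).2 hs).norm.mul_right 2) fun n => ?_
  rw [norm_mul]
  gcongr
  refine (norm_sub_le _ _).trans ?_
  rw [norm_one, norm_pow]
  linarith [pow_le_one₀ (norm_nonneg q) hq.le (n := n + 1)]

lemma tendsto_coeff_qSeries (hq : ‖q‖ < 1) (hs : Summable a)
    (ha : ∀ n, a (n + 1) * (1 - q ^ (n + 1)) = a n * (z - q ^ (n + 1))) (k : ℕ) :
    Tendsto (fun N => coeff k (qSeries q z a N)) atTop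
      (𝓝 (if k = 0 then ∑' n, a n else 0)) := by
  have hb := summable_qRecurrence_mul hq hs
  have h0 : Tendsto (fun N => q ^ N * ∑' n, a (n + 1) * (1 - q ^ (n + 1)) *
      (1 - q ^ (n + N + 1))⁻¹ ^ (k + 1)) atTop (𝓝 0) := by
    refine squeeze_zero_norm (a := fun N => ‖q‖ ^ N *
      ∑' n, ‖a (n + 1) * (1 - q ^ (n + 1))‖ * (1 - ‖q‖)⁻¹ ^ (k + 1)) (fun N => ?_) ?_
    · rw [norm_mul, norm_pow]
      gcongr
      exact tsum_of_norm_bounded (hb.norm.mul_right _).hasSum fun n =>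
        norm_mul_inv_one_sub_pow_le hq _ (n + N) (k + 1)
    · simpa using (tendsto_pow_atTop_nhds_zero_of_lt_one (norm_nonneg q) hq).mul_const
        (∑' n, ‖a (n + 1) * (1 - q ^ (n + 1))‖ * (1 - ‖q‖)⁻¹ ^ (k + 1))
  simp only [coeff_qSeries hq hs ha]
  simpa using tendsto_const_nhds.sub h0

lemma coeff_zero_qSeries_zero (hq : ‖q‖ < 1) (hs : Summable a) (ha0 : a 0 = 1)
    (ha : ∀ n, a (n + 1) * (1 - q ^ (n + 1)) = a n * (z - q ^ (n + 1))) :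
    coeff 0 (qSeries q z a 0) = 1 := by
  rw [coeff_qSeries hq hs ha, if_pos rfl, hs.tsum_eq_zero_add, ha0]
  have h : ∀ n, a (n + 1) * (1 - q ^ (n + 1)) * (1 - q ^ (n + 0 + 1))⁻¹ ^ (0 + 1) = a (n + 1) := by
    intro n
    have := one_sub_pow_ne_zero hq n
    simp [this]
  simp only [h]
  simp

/-- Constant terms of the telescoping relation, with F_0(0) = 1, give in the limit (q;q)_∞ = (z;q)_∞
A, and the left side is nonzero. -/
lemma tsum_ne_zero_of_qRecurrence (hq : ‖q‖ < 1) (hz : ‖z‖ < 1) (ha0 : a 0 = 1)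
    (ha : ∀ n, a (n + 1) * (1 - q ^ (n + 1)) = a n * (z - q ^ (n + 1))) :
    ∑' n, a n ≠ 0 := by
  have hs := summable_of_qRecurrence hq hz ha
  have hgeom : Summable fun n : ℕ => ‖q‖ ^ n := summable_geometric_of_lt_one (norm_nonneg q) hq
  have hqs : Summable fun n : ℕ => ‖-q ^ (n + 1)‖ := by
    simpa using (summable_nat_add_iff 1).2 hgeom
  have hzs : Summable fun n : ℕ => ‖-(z * q ^ n)‖ := by
    simpa using hgeom.mul_left ‖z‖
  have hprod : ∀ N, ∏ m ∈ Finset.range N, (1 + -q ^ (m + 1)) =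
      (∏ m ∈ Finset.range N, (1 + -(z * q ^ m))) * coeff 0 (qSeries q z a N) := by
    intro N
    induction N with
    | zero => simp [coeff_zero_qSeries_zero hq hs ha0 ha, -coeff_zero_eq_constantCoeff]
    | succ N ih =>
      have h := congrArg (coeff 0) (qSeries_telescoping hq hs ha N)
      simp only [sub_mul, map_sub, coeff_C_mul, coeff_zero_X_mul, sub_zero] at h
      rw [Finset.prod_range_succ, Finset.prod_range_succ, ih]
      linear_combination (∏ m ∈ Finset.range N, (1 + -(z * q ^ m))) * h
  have h1 := (multipliable_one_add_of_summable hqs).hasProd.tendsto_prod_nat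
  have h2 := (multipliable_one_add_of_summable hzs).hasProd.tendsto_prod_nat.mul
    (tendsto_coeff_qSeries hq hs ha 0)
  simp only [← hprod] at h2
  intro hA
  refine tprod_one_add_ne_zero_of_summable (fun n => ?_) hqs (tendsto_nhds_unique h1 h2 |>.trans ?_)
  · rw [← sub_eq_add_neg]
    exact one_sub_pow_ne_zero hq n
  · simp [hA]

/-- The sums `∑ a_{n+1} / (1 - q^(n+1))^k` over a `q`-hypergeometric sequence are, up to sign,
the complete homogeneous functions attached to the power sums `p`. -/
lemma exists_newton_of_qRecurrence (hq : ‖q‖ < 1) (hz : ‖z‖ < 1) (ha0 : a 0 = 1)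
    (ha : ∀ n, a (n + 1) * (1 - q ^ (n + 1)) = a n * (z - q ^ (n + 1))) {p : ℕ → ℂ}
    (hp : ∀ k, HasSum
      (fun m : ℕ => (1 - q ^ (m + 1))⁻¹ ^ (k + 1) - (1 - z * q ^ m)⁻¹ ^ (k + 1)) (p k)) :
    ∃ g : ℕ → ℂ, g 0 = 1 ∧
      (∀ k : ℕ, (k + 1) * g (k + 1) =
        ∑ ij ∈ Finset.HasAntidiagonal.antidiagonal k, g ij.1 * p ij.2) ∧
      ∀ k, HasSum (fun n => a (n + 1) / (1 - q ^ (n + 1)) ^ (k + 1)) (-g (k + 1)) := by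
  have hs := summable_of_qRecurrence hq hz ha
  refine ⟨fun k => coeff k (qSeries q z a 0), coeff_zero_qSeries_zero hq hs ha0 ha,
    newton_of_telescoping (one_sub_pow_ne_zero hq) (one_sub_mul_pow_ne_zero hq hz)
      (qSeries_telescoping hq hs ha) (tsum_ne_zero_of_qRecurrence hq hz ha0 ha)
      (tendsto_coeff_qSeries hq hs ha) hp, fun k => ?_⟩
  -- The coefficient of index k + 1 has exponent k + 2; the factor 1 - q^(n+1) cancels one power.
  have h := (summable_mul_inv_one_sub_pow hq (summable_qRecurrence_mul hq hs) 0 (k + 2)).hasSum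
  simp only [coeff_qSeries hq hs ha]
  convert h using 2 with n
  · have := one_sub_pow_ne_zero hq n
    rw [add_zero, pow_succ _ (k + 1), inv_pow]
    field_simp
  · simp

end QHypergeometric

/-! ### The polynomials -/

open MvPolynomial in
lemma exists_polynomial_of_newton (e : ℕ → ℕ → ℚ) (k : ℕ) :
    ∃ M : MvPolynomial (Fin k) ℚ, ∀ x g : ℕ → ℂ, g 0 = 1 →
      (∀ k : ℕ, (k + 1) * g (k + 1) = ∑ ij ∈ Finset.HasAntidiagonal.antidiagonal k,
        g ij.1 * ∑ s ∈ Finset.range (ij.2 + 1), (e ij.2 s : ℂ) * x s) →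
      aeval (fun i : Fin k => x i) M = g k := by
  induction k using Nat.strong_induction_on with
  | _ k ih =>
    cases k with
    | zero => exact ⟨1, fun x g hg _ => by simp [hg]⟩
    | succ k =>
      choose M hM using ih
      refine ⟨C ((1 : ℚ) / (k + 1)) *
        ∑ ij ∈ (Finset.HasAntidiagonal.antidiagonal k).attach,
          rename (Fin.castLE (Finset.HasAntidiagonal.antidiagonal.fst_le ij.2 |>.trans k.le_succ))
            (M ij.1.1 (Nat.lt_succ_of_le (Finset.HasAntidiagonal.antidiagonal.fst_le ij.2))) *
          ∑ s : Fin (ij.1.2 + 1), C (e ij.1.2 s) *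
            X (Fin.castLE (Nat.succ_le_succ (Finset.HasAntidiagonal.antidiagonal.snd_le ij.2)) s),
        fun x g hg hrec => ?_⟩
      have hk : (k : ℂ) + 1 ≠ 0 := by exact_mod_cast k.succ_ne_zero
      refine mul_left_cancel₀ hk ?_
      rw [hrec k, ← Finset.sum_attach (Finset.HasAntidiagonal.antidiagonal k)]
      simp only [map_mul, map_sum, aeval_rename, aeval_C, aeval_X, eq_ratCast,
        Function.comp_def, Fin.val_castLE]
      push_cast
      rw [← mul_assoc, mul_one_div_cancel hk, one_mul]
      refine Finset.sum_congr rfl fun ij _ => ?_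
      rw [hM _ _ x g hg hrec, Finset.sum_range]

/-! ### The two families of sums -/

lemma qPoch_succ (a q : ℂ) (n : ℕ) : qPoch a q (n + 1) = qPoch a q n * (1 - a * q ^ n) :=
  Finset.prod_range_succ _ _

lemma qPoch_self_ne_zero {q : ℂ} (hq : ‖q‖ < 1) (n : ℕ) : qPoch q q n ≠ 0 := by
  refine Finset.prod_ne_zero_iff.2 fun j _ => ?_
  rw [← pow_succ']
  exact one_sub_pow_ne_zero hq j

lemma qPoch_div_recurrence {q z : ℂ} (hq : ‖q‖ < 1) (hz : z ≠ 0) (n : ℕ) :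
    qPoch (q / z) q (n + 1) * z ^ (n + 1) / qPoch q q (n + 1) * (1 - q ^ (n + 1)) =
      qPoch (q / z) q n * z ^ n / qPoch q q n * (z - q ^ (n + 1)) := by
  have h1 := one_sub_pow_ne_zero hq n
  have h2 := qPoch_self_ne_zero hq n
  rw [qPoch_succ, qPoch_succ q q, ← pow_succ']
  field_simp
  ring

lemma qPoch_zero_recurrence {q : ℂ} (hq : ‖q‖ < 1) (n : ℕ) :
    (-1) ^ (n + 1) * q ^ ((n + 1) * (n + 2) / 2) / qPoch q q (n + 1) * (1 - q ^ (n + 1)) =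
      (-1) ^ n * q ^ (n * (n + 1) / 2) / qPoch q q n * (0 - q ^ (n + 1)) := by
  have h1 := one_sub_pow_ne_zero hq n
  have h2 := qPoch_self_ne_zero hq n
  have h3 : (n + 1) * (n + 2) / 2 = n * (n + 1) / 2 + (n + 1) := by
    rw [show (n + 1) * (n + 2) = n * (n + 1) + (n + 1) * 2 by ring,
      Nat.add_mul_div_right _ _ two_pos]
  rw [qPoch_succ, ← pow_succ', h3, pow_add]
  field_simp
  ring

open MvPolynomial in
/-- The polynomials of the theorem, normalised for `k = 1, 2`. -/
lemma exists_polynomials_of_newton :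
    ∃ M : (k : ℕ) → MvPolynomial (Fin k) ℚ,
      (∀ k : ℕ, ∀ x g : ℕ → ℂ, g 0 = 1 →
        (∀ k : ℕ, (k + 1) * g (k + 1) = ∑ ij ∈ Finset.HasAntidiagonal.antidiagonal k,
          g ij.1 * ∑ s ∈ Finset.range (ij.2 + 1), ((binomPoly ij.2).coeff s : ℂ) * x s) →
        aeval (fun i : Fin k => x i) (M k) = g k) ∧
      M 1 = X 0 ∧ M 2 = C (1 / 2 : ℚ) * (X 0 ^ 2 + X 0 + X 1) := by
  choose M hM using exists_polynomial_of_newton fun k s => (binomPoly k).coeff s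
  -- Overriding the values at 1 and 2 makes the normalisation hold by `rfl`; the recurrence then
  -- checks them: 2 g_2 = x_0² + (x_0 + x_1).
  refine ⟨fun
    | 1 => X 0
    | 2 => C (1 / 2 : ℚ) * (X 0 ^ 2 + X 0 + X 1)
    | k => M k, fun k x g hg hrec => ?_, rfl, rfl⟩
  have h1 : g 1 = x 0 := by
    have h := hrec 0
    simp [binomPoly, hg] at h
    exact h
  match k with
  | 0 => exact hM 0 x g hg hrec
  | 1 => simp [h1]
  | 2 =>
    have h := hrec 1
    simp [binomPoly, hg, h1, Finset.Nat.antidiagonal_succ, Finset.sum_range_succ,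
      Polynomial.coeff_one, Polynomial.coeff_X] at h
    simp
    linear_combination (-1 / 2) * h
  | k + 3 => exact hM (k + 3) x g hg hrec

theorem theorem1p5 :
    ∃ M : (k : ℕ) → MvPolynomial (Fin k) ℚ,
      (∀ k : ℕ, 1 ≤ k → ∀ q : ℂ, ‖q‖ < 1 →
        (∀ z : ℂ, ‖z‖ < 1 → z ≠ 0 →
          HasSum
            (fun n : ℕ => qPoch (q / z) q (n + 1) * z ^ (n + 1) /
              ((1 - q ^ (n + 1)) ^ k * qPoch q q (n + 1)))
            (-(MvPolynomial.aeval (fun i : Fin k => frakS ((i : ℕ) : ℂ) z q) (M k)))) ∧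
        HasSum
          (fun n : ℕ => (-1) ^ (n + 1) * q ^ ((n + 1) * (n + 2) / 2) /
            ((1 - q ^ (n + 1)) ^ k * qPoch q q (n + 1)))
          (-(MvPolynomial.aeval (fun i : Fin k => frakS ((i : ℕ) : ℂ) 0 q) (M k)))) ∧
      M 1 = MvPolynomial.X 0 ∧
      M 2 = MvPolynomial.C (1 / 2 : ℚ) *
        (MvPolynomial.X 0 ^ 2 + MvPolynomial.X 0 + MvPolynomial.X 1) := by
  obtain ⟨M, hM, hM1, hM2⟩ := exists_polynomials_of_newton
  refine ⟨M, fun k hk q hq => ?_, hM1, hM2⟩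
  obtain ⟨k, rfl⟩ := Nat.exists_eq_add_of_le' hk
  -- Only the recurrence and the initial value 1 matter, so z ≠ 0 and the limiting case z = 0 are
  -- treated alike.
  have key : ∀ (z : ℂ) (b : ℕ → ℂ), ‖z‖ < 1 → b 0 / qPoch q q 0 = 1 →
      (∀ n, b (n + 1) / qPoch q q (n + 1) * (1 - q ^ (n + 1)) =
        b n / qPoch q q n * (z - q ^ (n + 1))) →
      HasSum (fun n => b (n + 1) / ((1 - q ^ (n + 1)) ^ (k + 1) * qPoch q q (n + 1)))
        (-(MvPolynomial.aeval (fun i : Fin (k + 1) => frakS ((i : ℕ) : ℂ) z q) (M (k + 1)))) := by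
    intro z b hz hb0 hb
    obtain ⟨g, hg0, hg, hsum⟩ := exists_newton_of_qRecurrence
      (a := fun n => b n / qPoch q q n) hq hz hb0 hb (hasSum_inv_pow_sub_inv_pow hq hz)
    rw [hM (k + 1) (fun s => frakS s z q) g hg0 hg]
    simpa only [div_div, mul_comm] using hsum k
  refine ⟨fun z hz hz0 => key z (fun n => qPoch (q / z) q n * z ^ n) hz (by simp [qPoch])
    (qPoch_div_recurrence hq hz0), ?_⟩
  exact key 0 (fun n => (-1) ^ n * q ^ (n * (n + 1) / 2)) (by simp) (by simp [qPoch])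
    (qPoch_zero_recurrence hq)
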